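/- A Boolean vector is an element of $\{0,1\}^d$, and $a\cdot b=\sum_{i=1}^d a_ib_i$ is the inner product over the reals. In the two-party Hitting Set Existence problem $\mathrm{HSE}_{N,d}$, Alice receives a set $A\subseteq\{0,1\}^d$ and Bob a set $B\subseteq\{0,1\}^d$ with $|A|=|B|=N$, and they must output $1$ if and only if there is a vector $a\in A$ such that $a\cdot b\neq 0$ for all $b\in B$. A randomized (public-coin) two-party protocol is a probability distribution over deterministic protocol trees, in which at each internal node one party sends a bit depending on that party's own input and on the bits sent so far, and each leaf is labelled with the output. It solves $\mathrm{HSE}_{N,d}$ if on every input pair its output is correct with probability at least $2/3$. Its cost is the maximum number of bits exchanged, over all inputs and all outcomes of the random coins. **Theorem.** There is an absolute constant $c>0$ such that for every $N$ and $d=2\lceil\log_2 N\rceil+1$ (with $d=1$ for $N=0$), every randomized two-party protocol that solves $\mathrm{HSE}_{N,d}$ has cost at least $cN$. That is, $\mathrm{HSE}$ on sets of $N$ Boolean vectors of dimension $d=2\lceil\log_2 N\rceil+1$ requires $\Omega(N)$ bits of randomized communication. -/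

import Mathlib

/-- A deterministic two-party communication protocol with inputs in `X` (Alice) and `Y` (Bob) and
one output bit: a binary tree in which each leaf carries the common output, and each internal node
is owned by one party, who sends one bit that depends on that party's own input and on the node
(that is, on the bits sent so far). -/
inductive Protocol (X Y : Type) : Type
  | output (b : Bool) : Protocol X Y
  | alice (send : X → Bool) (onFalse onTrue : Protocol X Y) : Protocol X Y
  | bob (send : Y → Bool) (onFalse onTrue : Protocol X Y) : Protocol X Y

namespace Protocol

variable {X Y : Type}

/-- The output of the protocol on the input pair `(x, y)`. -/
def eval : Protocol X Y → X → Y → Bool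
  | output b, _, _ => b
  | alice s P Q, x, y => if s x then Q.eval x y else P.eval x y
  | bob s P Q, x, y => if s y then Q.eval x y else P.eval x y

/-- The number of bits exchanged on the input pair `(x, y)`. -/
def bits : Protocol X Y → X → Y → ℕ
  | output _, _, _ => 0
  | alice s P Q, x, y => (if s x then Q.bits x y else P.bits x y) + 1
  | bob s P Q, x, y => (if s y then Q.bits x y else P.bits x y) + 1

end Protocol

/-- A randomized (public-coin) two-party protocol: a probability distribution over deterministic
protocols. Private-coin protocols are a special case. -/
abbrev RandomizedProtocol (X Y : Type) : Type := PMF (Protocol X Y)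

namespace RandomizedProtocol

variable {X Y : Type}

/-- The randomized protocol decides the predicate `f` with error at most `1/3`: on every input
pair, its output is correct with probability at least `2/3`. -/
def Decides (R : RandomizedProtocol X Y) (f : X → Y → Prop) : Prop :=
  ∀ x y, 2 / 3 ≤ R.toOuterMeasure {P | P.eval x y = true ↔ f x y}

/-- The randomized protocol exchanges at most `k` bits in the worst case, over all input pairs
and all outcomes of the coins. -/
def CostAtMost (R : RandomizedProtocol X Y) (k : ℕ) : Prop :=
  ∀ P ∈ R.support, ∀ x y, P.bits x y ≤ k

end RandomizedProtocol

/-- The inner product over the reals of two Boolean vectors, read as 0/1 vectors. -/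
noncomputable def boolInner {d : ℕ} (a b : Fin d → Bool) : ℝ :=
  ∑ i, ((a i).toNat : ℝ) * ((b i).toNat : ℝ)

/-- The inputs of one party: sets of exactly `N` Boolean vectors of dimension `d`. -/
abbrev VectorSet (N d : ℕ) : Type := {A : Finset (Fin d → Bool) // A.card = N}

/-- Hitting Set Existence: some vector of `A` is orthogonal to no vector of `B`. -/
def HittingSetExists {N d : ℕ} (A B : VectorSet N d) : Prop :=
  ∃ a ∈ A.1, ∀ b ∈ B.1, boolInner a b ≠ 0

/-! Set disjointness on N points embeds in the problem. Alice's vector for i carries the binary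
digits of i and their complement, Bob's vector for j the same digits flipped, so they are orthogonal
on the digits exactly when i = j. The last coordinate then makes i hit everything if and only if i
lies in both sets.

Disjointness needs linear communication because a short protocol cannot tell random disjoint pairs
(x ⊆ A, y ⊆ Aᶜ) from pairs with one element i added to both. On a leaf rectangle, adding i changes
the acceptance means by discrete derivatives. The level-one inequality (`sum_mul_cubeMean_sign_le`,
`sum_abs_sub_le`) bounds their sum by θ·n·q plus (2/θ)·q log(1/q), with q the mass of the leaf.
Summed over leaves, the masses give 1 and the entropies at most the cost (`sum_negMulLog_le`).
Correctness forces a gap of order n between the two distributions, so the cost is of order n. -/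

/-- The average of `f` over all subsets of `A`. -/
noncomputable def cubeMean {ι : Type*} (A : Finset ι) (f : Finset ι → ℝ) : ℝ :=
  (∑ x ∈ A.powerset, f x) / 2 ^ A.card

/-! ### Means on the cube of subsets and the level-one inequality. -/

section CubeMean

variable {ι : Type*}

theorem cubeMean_congr {A : Finset ι} {f g : Finset ι → ℝ} (h : ∀ x ⊆ A, f x = g x) :
    cubeMean A f = cubeMean A g := by
  unfold cubeMean
  rw [Finset.sum_congr rfl fun x hx => h x (Finset.mem_powerset.1 hx)]

theorem cubeMean_const (A : Finset ι) (c : ℝ) : cubeMean A (fun _ => c) = c := by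
  simp [cubeMean, Finset.card_powerset]

theorem cubeMean_mono {A : Finset ι} {f g : Finset ι → ℝ} (h : ∀ x ⊆ A, f x ≤ g x) :
    cubeMean A f ≤ cubeMean A g := by
  unfold cubeMean
  gcongr with x hx
  exact h x (Finset.mem_powerset.1 hx)

theorem cubeMean_nonneg {A : Finset ι} {f : Finset ι → ℝ} (h : ∀ x, 0 ≤ f x) :
    0 ≤ cubeMean A f := by
  simpa [cubeMean_const] using cubeMean_mono (A := A) (f := fun _ => 0) fun x _ => h x

theorem cubeMean_le_one {A : Finset ι} {f : Finset ι → ℝ} (h : ∀ x, f x ≤ 1) :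
    cubeMean A f ≤ 1 := by
  simpa [cubeMean_const] using cubeMean_mono (A := A) (g := fun _ => 1) fun x _ => h x

theorem cubeMean_sum {κ : Type*} (s : Finset κ) (A : Finset ι) (f : κ → Finset ι → ℝ) :
    cubeMean A (fun x => ∑ j ∈ s, f j x) = ∑ j ∈ s, cubeMean A (f j) := by
  simp only [cubeMean]
  rw [Finset.sum_comm, Finset.sum_div]

theorem cubeMean_const_mul (A : Finset ι) (c : ℝ) (f : Finset ι → ℝ) :
    cubeMean A (fun x => c * f x) = c * cubeMean A f := by
  simp only [cubeMean]
  rw [← Finset.mul_sum, mul_div_assoc]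

theorem cubeMean_mul_const (A : Finset ι) (c : ℝ) (f : Finset ι → ℝ) :
    cubeMean A (fun x => f x * c) = cubeMean A f * c := by
  simp only [mul_comm _ c, cubeMean_const_mul]

theorem hasSum_cubeMean {κ : Type*} (A : Finset ι) {f : κ → Finset ι → ℝ} {g : Finset ι → ℝ}
    (h : ∀ x, HasSum (fun j => f j x) (g x)) :
    HasSum (fun j => cubeMean A (f j)) (cubeMean A g) :=
  (hasSum_sum fun x _ => h x).div_const _

variable [DecidableEq ι]

theorem cubeMean_eq_half_add {A : Finset ι} {i : ι} (hi : i ∈ A) (f : Finset ι → ℝ) :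
    cubeMean A f =
      (cubeMean (A.erase i) f + cubeMean (A.erase i) fun x => f (insert i x)) / 2 := by
  have hs : ∑ x ∈ A.powerset, f x =
      ∑ x ∈ (A.erase i).powerset, f x + ∑ x ∈ (A.erase i).powerset, f (insert i x) := by
    rw [← Finset.sum_powerset_insert (Finset.notMem_erase i A), Finset.insert_erase hi]
  simp only [cubeMean]
  rw [hs, ← Finset.card_erase_add_one hi, pow_succ]
  field_simp

/-- The first-order Fourier coefficient of `f` on the cube of subsets of `A`. -/
theorem cubeMean_mul_sign {A : Finset ι} {i : ι} (hi : i ∈ A) (f : Finset ι → ℝ) :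
    cubeMean A (fun x => f x * if i ∈ x then 1 else -1) =
      (cubeMean (A.erase i) (fun x => f (insert i x)) - cubeMean (A.erase i) f) / 2 := by
  rw [cubeMean_eq_half_add hi]
  have h1 : cubeMean (A.erase i) (fun x => f x * if i ∈ x then 1 else -1) =
      cubeMean (A.erase i) (fun x => f x * (-1)) := by
    refine cubeMean_congr fun x hx => ?_
    rw [if_neg fun h => Finset.notMem_erase i A (hx h)]
  rw [h1, cubeMean_mul_const]
  simp only [Finset.mem_insert_self, if_true, mul_one]
  ring

/-- The signs are independent, so the exponential moment factors into a product of cosh (c i). -/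
theorem cubeMean_exp_le (A : Finset ι) (c : ι → ℝ) :
    cubeMean A (fun x => Real.exp (∑ i ∈ A, c i * if i ∈ x then 1 else -1)) ≤
      Real.exp (∑ i ∈ A, c i ^ 2 / 2) := by
  have h : ∑ x ∈ A.powerset, Real.exp (∑ i ∈ A, c i * if i ∈ x then 1 else -1) =
      ∏ i ∈ A, (Real.exp (c i) + Real.exp (-c i)) := by
    rw [Finset.prod_add]
    refine Finset.sum_congr rfl fun x hx => ?_
    rw [Finset.mem_powerset] at hx
    rw [← Real.exp_sum, ← Real.exp_sum, ← Real.exp_add, add_comm, ← Finset.sum_sdiff hx]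
    congr 2
    · refine Finset.sum_congr rfl fun i hi => ?_
      rw [if_neg (Finset.mem_sdiff.1 hi).2]; ring
    · refine Finset.sum_congr rfl fun i hi => ?_
      rw [if_pos hi]; ring
  rw [cubeMean, h, ← Finset.prod_const, ← Finset.prod_div_distrib, Real.exp_sum]
  refine Finset.prod_le_prod (fun i _ => by positivity) fun i _ => ?_
  rw [← Real.cosh_eq]
  exact Real.cosh_le_exp_half_sq _

/-- Level-one inequality, tested against a linear form. -/
theorem sum_mul_cubeMean_sign_le (A : Finset ι) (c : ι → ℝ) {f : Finset ι → ℝ}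
    (h0 : ∀ x, 0 ≤ f x) (h1 : ∀ x, f x ≤ 1) :
    ∑ i ∈ A, c i * cubeMean A (fun x => f x * if i ∈ x then 1 else -1) ≤
      cubeMean A f * (∑ i ∈ A, c i ^ 2 / 2) + Real.negMulLog (cubeMean A f) := by
  set F := cubeMean A f with hF
  set l : Finset ι → ℝ := fun x => ∑ i ∈ A, c i * if i ∈ x then 1 else -1 with hl
  have hsum : ∑ i ∈ A, c i * cubeMean A (fun x => f x * if i ∈ x then 1 else -1) =
      cubeMean A (fun x => f x * l x) := by
    simp only [← cubeMean_const_mul, ← cubeMean_sum, hl, Finset.mul_sum]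
    refine cubeMean_congr fun x _ => Finset.sum_congr rfl fun i _ => by ring
  have hF0 : 0 ≤ F := cubeMean_nonneg h0
  rw [hsum]
  rcases hF0.eq_or_lt with hz | hpos
  · have hzero : ∀ x ∈ A.powerset, f x = 0 := by
      rw [← Finset.sum_eq_zero_iff_of_nonneg fun x _ => h0 x]
      have := hz.symm
      rw [hF, cubeMean, div_eq_zero_iff] at this
      exact this.resolve_right (by positivity)
    rw [cubeMean_congr (g := fun _ => 0) fun x hx => by
      rw [hzero x (Finset.mem_powerset.2 hx), zero_mul], cubeMean_const, ← hz]
    simp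
  -- This shift makes exp(Σ c²/2 - a) equal to F; the bound 1 + t ≤ exp t at t = l - a then gives
  -- the inequality.
  · set a := ∑ i ∈ A, c i ^ 2 / 2 - Real.log F with ha
    have key : cubeMean A (fun x => f x * l x) + (1 - a) * F ≤ F := by
      calc cubeMean A (fun x => f x * l x) + (1 - a) * F
          = cubeMean A (fun x => f x * (l x - a + 1)) := by
            rw [hF, ← cubeMean_const_mul]
            simp only [cubeMean]
            rw [← add_div, ← Finset.sum_add_distrib]
            congr 1
            refine Finset.sum_congr rfl fun x _ => by ring
        _ ≤ cubeMean A (fun x => Real.exp (l x) * Real.exp (-a)) := by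
            refine cubeMean_mono fun x _ => ?_
            rw [← Real.exp_add, ← sub_eq_add_neg]
            calc f x * (l x - a + 1) ≤ f x * Real.exp (l x - a) :=
                  mul_le_mul_of_nonneg_left (Real.add_one_le_exp _) (h0 x)
              _ ≤ 1 * Real.exp (l x - a) :=
                  mul_le_mul_of_nonneg_right (h1 x) (Real.exp_pos _).le
              _ = _ := one_mul _
        _ ≤ Real.exp (∑ i ∈ A, c i ^ 2 / 2) * Real.exp (-a) := by
            rw [cubeMean_mul_const]
            exact mul_le_mul_of_nonneg_right (cubeMean_exp_le A c) (Real.exp_pos _).le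
        _ = F := by
            rw [← Real.exp_add, ha]
            simp [Real.exp_log hpos]
    rw [Real.negMulLog]
    rw [ha] at key
    linarith

/-- The level-one inequality with coefficients ±θ matching the signs of the derivatives; each
Fourier coefficient is half a derivative. -/
theorem sum_abs_sub_le (A : Finset ι) {f : Finset ι → ℝ} {θ : ℝ} (hθ : 0 < θ)
    (h0 : ∀ x, 0 ≤ f x) (h1 : ∀ x, f x ≤ 1) :
    ∑ i ∈ A, |cubeMean (A.erase i) (fun x => f (insert i x)) - cubeMean (A.erase i) f| ≤
      θ * A.card * cubeMean A f + 2 / θ * Real.negMulLog (cubeMean A f) := by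
  set D : ι → ℝ := fun i =>
    cubeMean (A.erase i) (fun x => f (insert i x)) - cubeMean (A.erase i) f with hD
  have h := sum_mul_cubeMean_sign_le A (fun i => θ * if 0 ≤ D i then 1 else -1) h0 h1
  have hl : ∑ i ∈ A, (θ * if 0 ≤ D i then 1 else -1) *
      cubeMean A (fun x => f x * if i ∈ x then 1 else -1) = θ / 2 * ∑ i ∈ A, |D i| := by
    rw [Finset.mul_sum]
    refine Finset.sum_congr rfl fun i hi => ?_
    rw [cubeMean_mul_sign hi]
    change _ * (D i / 2) = _
    split_ifs with hd
    · rw [abs_of_nonneg hd]; ring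
    · rw [abs_of_neg (not_le.1 hd)]; ring
  have hr : ∑ i ∈ A, (θ * if 0 ≤ D i then (1 : ℝ) else -1) ^ 2 / 2 = A.card * (θ ^ 2 / 2) := by
    rw [← nsmul_eq_mul]
    refine Finset.sum_eq_card_nsmul fun i _ => ?_
    split_ifs <;> ring
  rw [hl, hr] at h
  have := mul_le_mul_of_nonneg_left h (by positivity : 0 ≤ 2 / θ)
  calc ∑ i ∈ A, |D i| = 2 / θ * (θ / 2 * ∑ i ∈ A, |D i|) := by field_simp
    _ ≤ _ := this
    _ = _ := by field_simp

end CubeMean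

/-! ### Leaves of a protocol and the entropy of their distribution. -/

/-- The leaves of a protocol tree: each is a rectangle, the rectangles partition the inputs, and
the depths satisfy Kraft's equality. -/
theorem Protocol.exists_leaves {X Y : Type} (P : Protocol X Y) :
    ∃ (κ : Type) (_ : Fintype κ) (row : κ → X → ℝ) (col : κ → Y → ℝ) (depth : κ → ℕ)
      (out : κ → Bool),
      (∀ j x, 0 ≤ row j x ∧ row j x ≤ 1) ∧ (∀ j y, 0 ≤ col j y ∧ col j y ≤ 1) ∧
      (∀ (h : Bool → ℕ → ℝ) x y,
        ∑ j, h (out j) (depth j) * (row j x * col j y) = h (P.eval x y) (P.bits x y)) ∧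
      ∑ j, (1 / 2 : ℝ) ^ depth j = 1 := by
  induction P with
  | output b =>
    exact ⟨Unit, inferInstance, fun _ _ => 1, fun _ _ => 1, fun _ => 0, fun _ => b,
      by simp, by simp, by simp [Protocol.eval, Protocol.bits], by simp⟩
  | alice s P Q ihP ihQ =>
    obtain ⟨κ, _, r, c, d, o, hr, hc, hs, hk⟩ := ihP
    obtain ⟨κ', _, r', c', d', o', hr', hc', hs', hk'⟩ := ihQ
    refine ⟨κ ⊕ κ', inferInstance,
      Sum.elim (fun j x => if s x then 0 else r j x) (fun j x => if s x then r' j x else 0),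
      Sum.elim c c', Sum.elim (fun j => d j + 1) (fun j => d' j + 1), Sum.elim o o',
      ?_, ?_, ?_, ?_⟩
    · rintro (j | j) x
      · simp only [Sum.elim_inl]; split_ifs <;> simp [hr]
      · simp only [Sum.elim_inr]; split_ifs <;> simp [hr']
    · rintro (j | j) x
      · exact hc j x
      · exact hc' j x
    · intro h x y
      have h1 := hs (fun b k => h b (k + 1)) x y
      have h2 := hs' (fun b k => h b (k + 1)) x y
      simp only [Fintype.sum_sum_type, Sum.elim_inl, Sum.elim_inr, Protocol.eval, Protocol.bits]
      split_ifs <;> simp [h1, h2]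
    · simp only [Fintype.sum_sum_type, Sum.elim_inl, Sum.elim_inr, pow_succ, ← Finset.sum_mul,
        hk, hk']
      norm_num
  | bob s P Q ihP ihQ =>
    obtain ⟨κ, _, r, c, d, o, hr, hc, hs, hk⟩ := ihP
    obtain ⟨κ', _, r', c', d', o', hr', hc', hs', hk'⟩ := ihQ
    refine ⟨κ ⊕ κ', inferInstance, Sum.elim r r',
      Sum.elim (fun j y => if s y then 0 else c j y) (fun j y => if s y then c' j y else 0),
      Sum.elim (fun j => d j + 1) (fun j => d' j + 1), Sum.elim o o', ?_, ?_, ?_, ?_⟩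
    · rintro (j | j) x
      · exact hr j x
      · exact hr' j x
    · rintro (j | j) x
      · simp only [Sum.elim_inl]; split_ifs <;> simp [hc]
      · simp only [Sum.elim_inr]; split_ifs <;> simp [hc']
    · intro h x y
      have h1 := hs (fun b k => h b (k + 1)) x y
      have h2 := hs' (fun b k => h b (k + 1)) x y
      simp only [Fintype.sum_sum_type, Sum.elim_inl, Sum.elim_inr, Protocol.eval, Protocol.bits]
      split_ifs <;> simp [h1, h2]
    · simp only [Fintype.sum_sum_type, Sum.elim_inl, Sum.elim_inr, pow_succ, ← Finset.sum_mul,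
        hk, hk']
      norm_num

/-- Gibbs' inequality against the weight `2 ^ (-d)`. -/
theorem negMulLog_le_of_depth {q : ℝ} (hq : 0 ≤ q) (d : ℕ) :
    Real.negMulLog q ≤ q * d + (1 / 2) ^ d - q := by
  rcases hq.eq_or_lt with rfl | hpos
  · simp
  have hlog : Real.log ((1 / 2) ^ d / q) ≤ (1 / 2) ^ d / q - 1 :=
    Real.log_le_sub_one_of_pos (by positivity)
  rw [Real.log_div (by positivity) hpos.ne', Real.log_pow, one_div, Real.log_inv] at hlog
  -- Entropy is in nats and depth in bits; the factor log 2 is given away.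
  have h2 : Real.log 2 ≤ 1 := by linarith [Real.log_two_lt_d9]
  have h3 : (d : ℝ) * Real.log 2 ≤ d := by
    simpa using mul_le_mul_of_nonneg_left h2 d.cast_nonneg
  have h4 : -Real.log q ≤ d + ((2⁻¹ : ℝ) ^ d / q - 1) := by linarith
  calc Real.negMulLog q = q * -Real.log q := by rw [Real.negMulLog]; ring
    _ ≤ q * (d + ((2⁻¹ : ℝ) ^ d / q - 1)) := mul_le_mul_of_nonneg_left h4 hq
    _ = _ := by field_simp; ring

/-- A distribution on the leaves of a binary tree has entropy at most the average depth. -/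
theorem sum_negMulLog_le {κ : Type*} [Fintype κ] {q : κ → ℝ} {d : κ → ℕ} {k : ℝ}
    (hq : ∀ j, 0 ≤ q j) (hsum : ∑ j, q j = 1) (hkraft : ∑ j, (1 / 2 : ℝ) ^ d j = 1)
    (hk : ∑ j, d j * q j ≤ k) : ∑ j, Real.negMulLog (q j) ≤ k := by
  calc ∑ j, Real.negMulLog (q j) ≤ ∑ j, (q j * d j + (1 / 2) ^ d j - q j) :=
        Finset.sum_le_sum fun j _ => negMulLog_le_of_depth (hq j) _
    _ = ∑ j, d j * q j := by
        rw [Finset.sum_sub_distrib, Finset.sum_add_distrib, hsum, hkraft]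
        simp [mul_comm]
    _ ≤ k := hk

/-! ### Disjoint against uniquely intersecting pairs. -/

section Disjointness

variable {ι : Type*} [Fintype ι] [DecidableEq ι]

/-- `2 ^ n` times the mean of `h` over random disjoint pairs: `A` is a random set, `x` a random
subset of `A` and `y` a random subset of its complement. -/
noncomputable def disjointMass (h : Finset ι → Finset ι → ℝ) : ℝ :=
  ∑ A : Finset ι, cubeMean A fun x => cubeMean Aᶜ fun y => h x y

/-- `n * 2 ^ (n - 1)` times the mean of `h` over random pairs that meet in one element. -/
noncomputable def intersectMass (h : Finset ι → Finset ι → ℝ) : ℝ :=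
  ∑ A : Finset ι, ∑ i ∈ A,
    cubeMean (A.erase i) fun x => cubeMean Aᶜ fun y => h (insert i x) (insert i y)

/-- Moving i across the partition, (A, i) ↦ (A ∪ {i}, i), is a bijection. -/
theorem sum_sum_compl_eq (φ : Finset ι → ι → ℝ) :
    ∑ A : Finset ι, ∑ i ∈ Aᶜ, φ A i = ∑ A : Finset ι, ∑ i ∈ A, φ (A.erase i) i := by
  rw [Finset.sum_sigma', Finset.sum_sigma']
  refine Finset.sum_bij' (fun p _ => ⟨insert p.2 p.1, p.2⟩) (fun p _ => ⟨p.1.erase p.2, p.2⟩)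
    ?_ ?_ ?_ ?_ ?_
  · simp
  · simp
  · rintro ⟨A, i⟩ h
    simp only [Finset.mem_sigma, Finset.mem_univ, true_and, Finset.mem_compl] at h
    simp [Finset.erase_insert h]
  · rintro ⟨A, i⟩ h
    simp only [Finset.mem_sigma, Finset.mem_univ, true_and] at h
    simp [Finset.insert_erase h]
  · rintro ⟨A, i⟩ h
    simp only [Finset.mem_sigma, Finset.mem_univ, true_and, Finset.mem_compl] at h
    simp [Finset.erase_insert h]

theorem disjointMass_mul (f g : Finset ι → ℝ) :
    disjointMass (fun x y => f x * g y) = ∑ A : Finset ι, cubeMean A f * cubeMean Aᶜ g := by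
  simp only [disjointMass, cubeMean_const_mul, cubeMean_mul_const]

theorem intersectMass_mul (f g : Finset ι → ℝ) :
    intersectMass (fun x y => f x * g y) = ∑ A : Finset ι, ∑ i ∈ A,
      cubeMean (A.erase i) (fun x => f (insert i x)) * cubeMean Aᶜ fun y => g (insert i y) := by
  simp only [intersectMass, cubeMean_const_mul, cubeMean_mul_const]

/-- Each i lies in A or in Aᶜ. Moving i in the second case puts both cases over the cubes of A \ {i}
and Aᶜ, the ones used by `intersectMass`. -/
theorem card_mul_disjointMass_mul (f g : Finset ι → ℝ) :
    Fintype.card ι * disjointMass (fun x y => f x * g y) = ∑ A : Finset ι, ∑ i ∈ A,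
      (cubeMean A f * cubeMean Aᶜ g + cubeMean (A.erase i) f * cubeMean (insert i Aᶜ) g) := by
  have h := sum_sum_compl_eq fun (A : Finset ι) (_ : ι) => cubeMean A f * cubeMean Aᶜ g
  simp only [Finset.compl_erase] at h
  simp only [Finset.sum_add_distrib]
  rw [← h, ← Finset.sum_add_distrib, disjointMass_mul, Finset.mul_sum]
  refine Finset.sum_congr rfl fun A _ => ?_
  rw [Finset.sum_add_sum_compl]
  simp

/-- The product of the increments hurts only when their signs differ; nonnegativity of u₁ and v₁
then absorbs it. -/
theorem mul_sub_abs_le {u₀ u₁ v₀ v₁ : ℝ} (hu₀ : 0 ≤ u₀) (hu₁ : 0 ≤ u₁) (hv₀ : 0 ≤ v₀)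
    (hv₁ : 0 ≤ v₁) : u₀ * v₀ - |u₁ - u₀| * v₀ - |v₁ - v₀| * u₀ ≤ u₁ * v₁ := by
  rcases abs_cases (u₁ - u₀) with ⟨h, h'⟩ | ⟨h, h'⟩ <;>
    rcases abs_cases (v₁ - v₀) with ⟨g, g'⟩ | ⟨g, g'⟩ <;> rw [h, g] <;> nlinarith

theorem half_sums_sub_le {u₀ u₁ v₀ v₁ : ℝ} (hu₀ : 0 ≤ u₀) (hu₁ : 0 ≤ u₁) (hv₀ : 0 ≤ v₀)
    (hv₁ : 0 ≤ v₁) :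
    (u₀ + u₁) / 2 * v₀ + u₀ * ((v₀ + v₁) / 2) - 2 * (u₁ * v₁) ≤
      5 / 2 * (|u₁ - u₀| * v₀ + u₀ * |v₁ - v₀|) := by
  have h := mul_sub_abs_le hu₀ hu₁ hv₀ hv₁
  have h1 := mul_le_mul_of_nonneg_right (le_abs_self (u₁ - u₀)) hv₀
  have h2 := mul_le_mul_of_nonneg_left (le_abs_self (v₁ - v₀)) hu₀
  nlinarith

/-- On rectangles the two masses nearly agree, up to an entropy term. -/
theorem disjointMass_sub_intersectMass_le {f g : Finset ι → ℝ} {θ : ℝ} (hθ : 0 < θ)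
    (hf : ∀ x, 0 ≤ f x ∧ f x ≤ 1) (hg : ∀ y, 0 ≤ g y ∧ g y ≤ 1) :
    Fintype.card ι * disjointMass (fun x y => f x * g y) -
        2 * intersectMass (fun x y => f x * g y) ≤
      5 / 2 * (θ * Fintype.card ι * disjointMass (fun x y => f x * g y) +
        2 / θ * ∑ A : Finset ι, Real.negMulLog (cubeMean A f * cubeMean Aᶜ g)) := by
  have nf (A : Finset ι) : 0 ≤ cubeMean A f := cubeMean_nonneg fun x => (hf x).1
  have ng (A : Finset ι) : 0 ≤ cubeMean A g := cubeMean_nonneg fun x => (hg x).1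
  have step : Fintype.card ι * disjointMass (fun x y => f x * g y) -
        2 * intersectMass (fun x y => f x * g y) ≤ ∑ A : Finset ι, ∑ i ∈ A, 5 / 2 *
      (|cubeMean (A.erase i) (fun x => f (insert i x)) - cubeMean (A.erase i) f| * cubeMean Aᶜ g +
        cubeMean (A.erase i) f * |cubeMean Aᶜ (fun x => g (insert i x)) - cubeMean Aᶜ g|) := by
    rw [card_mul_disjointMass_mul, intersectMass_mul, Finset.mul_sum, ← Finset.sum_sub_distrib]
    refine Finset.sum_le_sum fun A _ => ?_
    rw [Finset.mul_sum, ← Finset.sum_sub_distrib]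
    refine Finset.sum_le_sum fun i hi => ?_
    rw [cubeMean_eq_half_add hi f, cubeMean_eq_half_add (Finset.mem_insert_self i Aᶜ) g,
      Finset.erase_insert (by simpa using hi)]
    exact half_sums_sub_le (nf _) (cubeMean_nonneg fun x => (hf _).1) (ng _)
      (cubeMean_nonneg fun x => (hg _).1)
  -- The level-one inequality for g on Aᶜ needs i in Aᶜ, so i is moved back across the partition.
  have swap := sum_sum_compl_eq fun (A : Finset ι) (i : ι) => cubeMean A f *
    |cubeMean (Aᶜ.erase i) (fun x => g (insert i x)) - cubeMean (Aᶜ.erase i) g|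
  have swap' : ∑ A : Finset ι, ∑ i ∈ A, cubeMean (A.erase i) f *
        |cubeMean Aᶜ (fun x => g (insert i x)) - cubeMean Aᶜ g| =
      ∑ A : Finset ι, ∑ i ∈ Aᶜ, cubeMean A f *
        |cubeMean (Aᶜ.erase i) (fun x => g (insert i x)) - cubeMean (Aᶜ.erase i) g| := by
    rw [swap]
    refine Finset.sum_congr rfl fun A _ => Finset.sum_congr rfl fun i hi => ?_
    rw [Finset.compl_erase, Finset.erase_insert (by simpa using hi)]
  refine step.trans ?_
  simp only [← Finset.mul_sum, Finset.sum_add_distrib]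
  rw [swap', ← Finset.sum_add_distrib]
  refine mul_le_mul_of_nonneg_left ?_ (by norm_num)
  rw [disjointMass_mul, Finset.mul_sum, Finset.mul_sum, ← Finset.sum_add_distrib]
  refine Finset.sum_le_sum fun A _ => ?_
  rw [← Finset.sum_mul, ← Finset.mul_sum]
  have h1 := mul_le_mul_of_nonneg_right
    (sum_abs_sub_le A hθ (fun x => (hf x).1) fun x => (hf x).2) (ng Aᶜ)
  have h2 := mul_le_mul_of_nonneg_left
    (sum_abs_sub_le Aᶜ hθ (fun x => (hg x).1) fun x => (hg x).2) (nf A)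
  have hc : (A.card : ℝ) + Aᶜ.card = Fintype.card ι := by
    exact_mod_cast Finset.card_add_card_compl A
  rw [Real.negMulLog_mul, ← hc]
  linarith

theorem disjointMass_sum {κ : Type*} (s : Finset κ) (h : κ → Finset ι → Finset ι → ℝ) :
    disjointMass (fun x y => ∑ j ∈ s, h j x y) = ∑ j ∈ s, disjointMass (h j) := by
  simp only [disjointMass, cubeMean_sum]
  rw [Finset.sum_comm]

theorem intersectMass_sum {κ : Type*} (s : Finset κ) (h : κ → Finset ι → Finset ι → ℝ) :
    intersectMass (fun x y => ∑ j ∈ s, h j x y) = ∑ j ∈ s, intersectMass (h j) := by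
  simp only [intersectMass, cubeMean_sum]
  rw [Finset.sum_comm]
  refine Finset.sum_congr rfl fun A _ => ?_
  rw [Finset.sum_comm]

theorem hasSum_disjointMass {κ : Type*} {h : κ → Finset ι → Finset ι → ℝ}
    {h' : Finset ι → Finset ι → ℝ} (hs : ∀ x y, HasSum (fun j => h j x y) (h' x y)) :
    HasSum (fun j => disjointMass (h j)) (disjointMass h') :=
  hasSum_sum fun _ _ => hasSum_cubeMean _ fun _ => hasSum_cubeMean _ fun _ => hs _ _

theorem hasSum_intersectMass {κ : Type*} {h : κ → Finset ι → Finset ι → ℝ}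
    {h' : Finset ι → Finset ι → ℝ} (hs : ∀ x y, HasSum (fun j => h j x y) (h' x y)) :
    HasSum (fun j => intersectMass (h j)) (intersectMass h') :=
  hasSum_sum fun _ _ => hasSum_sum fun _ _ =>
    hasSum_cubeMean _ fun _ => hasSum_cubeMean _ fun _ => hs _ _

theorem disjointMass_const_mul (c : ℝ) (h : Finset ι → Finset ι → ℝ) :
    disjointMass (fun x y => c * h x y) = c * disjointMass h := by
  simp only [disjointMass, cubeMean_const_mul, Finset.mul_sum]

theorem intersectMass_const_mul (c : ℝ) (h : Finset ι → Finset ι → ℝ) :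
    intersectMass (fun x y => c * h x y) = c * intersectMass h := by
  simp only [intersectMass, cubeMean_const_mul, Finset.mul_sum]

theorem le_disjointMass {h : Finset ι → Finset ι → ℝ} {c : ℝ}
    (hc : ∀ x y, Disjoint x y → c ≤ h x y) : c * 2 ^ Fintype.card ι ≤ disjointMass h := by
  have : ∑ _A : Finset ι, c ≤ disjointMass h := by
    refine Finset.sum_le_sum fun A _ => ?_
    rw [← cubeMean_const A c]
    refine cubeMean_mono fun x hx => ?_
    rw [← cubeMean_const Aᶜ c]
    exact cubeMean_mono fun y hy => hc x y (disjoint_compl_right.mono hx hy)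
  simpa [mul_comm] using this

theorem two_mul_sum_card : 2 * ∑ A : Finset ι, (A.card : ℝ) =
    Fintype.card ι * 2 ^ Fintype.card ι := by
  have h := sum_sum_compl_eq fun (_ : Finset ι) (_ : ι) => (1 : ℝ)
  simp only [Finset.sum_const, nsmul_eq_mul, mul_one] at h
  rw [two_mul]
  nth_rw 1 [← h]
  rw [← Finset.sum_add_distrib, Finset.sum_congr rfl fun A _ => ?_, Finset.sum_const,
    Finset.card_univ, Fintype.card_finset, nsmul_eq_mul, mul_comm]
  · push_cast
    rfl
  · rw [add_comm]
    exact_mod_cast Finset.card_add_card_compl A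

theorem intersectMass_le {h : Finset ι → Finset ι → ℝ} {c : ℝ}
    (hc : ∀ x y, (x ∩ y).Nonempty → h x y ≤ c) :
    2 * intersectMass h ≤ c * (Fintype.card ι * 2 ^ Fintype.card ι) := by
  have : intersectMass h ≤ ∑ A : Finset ι, ∑ _i ∈ A, c := by
    refine Finset.sum_le_sum fun A _ => Finset.sum_le_sum fun i _ => ?_
    rw [← cubeMean_const (A.erase i) c]
    refine cubeMean_mono fun x _ => ?_
    rw [← cubeMean_const Aᶜ c]
    exact cubeMean_mono fun y _ => hc _ _ ⟨i, by simp⟩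
  rw [← two_mul_sum_card]
  simp only [Finset.sum_const, nsmul_eq_mul, ← Finset.sum_mul] at this
  linarith

/-- A protocol of cost `k` hardly distinguishes disjoint from intersecting pairs. -/
theorem Protocol.disjointMass_sub_intersectMass_le {X Y : Type} (P : Protocol X Y)
    (φ : Finset ι → X) (ψ : Finset ι → Y) {k : ℕ} (hk : ∀ x y, P.bits x y ≤ k) {θ : ℝ}
    (hθ : 0 < θ) :
    Fintype.card ι * disjointMass (fun x y => if P.eval (φ x) (ψ y) then 0 else 1) -
        2 * intersectMass (fun x y => if P.eval (φ x) (ψ y) then 0 else 1) ≤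
      5 / 2 * (θ * Fintype.card ι + 2 / θ * k) * 2 ^ Fintype.card ι := by
  obtain ⟨κ, _, row, col, depth, out, hrow, hcol, hsum, hkraft⟩ := P.exists_leaves
  set f : κ → Finset ι → ℝ := fun j x => row j (φ x) with hf
  set g : κ → Finset ι → ℝ := fun j y => col j (ψ y) with hg
  have hfb (j x) : 0 ≤ f j x ∧ f j x ≤ 1 := hrow j _
  have hgb (j x) : 0 ≤ g j x ∧ g j x ≤ 1 := hcol j _
  -- Different weights h yield the total leaf mass, the mean depth and the rejection indicator.
  have hsum' (h : Bool → ℕ → ℝ) (x y) : h (P.eval (φ x) (ψ y)) (P.bits (φ x) (ψ y)) =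
      ∑ j, h (out j) (depth j) * (f j x * g j y) := (hsum h _ _).symm
  have q0 (j) (A : Finset ι) : 0 ≤ cubeMean A (f j) * cubeMean Aᶜ (g j) :=
    mul_nonneg (cubeMean_nonneg fun x => (hfb j x).1) (cubeMean_nonneg fun x => (hgb j x).1)
  have q1 (j) (A : Finset ι) : cubeMean A (f j) * cubeMean Aᶜ (g j) ≤ 1 :=
    mul_le_one₀ (cubeMean_le_one fun x => (hfb j x).2) (cubeMean_nonneg fun x => (hgb j x).1)
      (cubeMean_le_one fun x => (hgb j x).2)
  have qsum (h : ℕ → ℝ) (A : Finset ι) :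
      ∑ j, h (depth j) * (cubeMean A (f j) * cubeMean Aᶜ (g j)) =
        cubeMean A fun x => cubeMean Aᶜ fun y => h (P.bits (φ x) (ψ y)) := by
    have key (x y) := hsum' (fun _ => h) x y
    simp only [key, cubeMean_sum, cubeMean_const_mul, cubeMean_mul_const]
  have qone (A : Finset ι) : ∑ j, cubeMean A (f j) * cubeMean Aᶜ (g j) = 1 := by
    simpa [cubeMean_const] using qsum (fun _ => 1) A
  have entropy (A : Finset ι) :
      ∑ j, Real.negMulLog (cubeMean A (f j) * cubeMean Aᶜ (g j)) ≤ k := by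
    refine sum_negMulLog_le (d := depth) (fun j => q0 j A) (qone A) hkraft ?_
    rw [qsum fun d => (d : ℝ)]
    rw [← cubeMean_const A (k : ℝ)]
    refine cubeMean_mono fun x _ => ?_
    rw [← cubeMean_const Aᶜ (k : ℝ)]
    exact cubeMean_mono fun y _ => by exact_mod_cast hk _ _
  have hD : disjointMass (fun x y => if P.eval (φ x) (ψ y) then 0 else 1) =
      ∑ j, (if out j then 0 else 1) * disjointMass fun x y => f j x * g j y := by
    have key (x y) := hsum' (fun b _ => if b then 0 else 1) x y
    simp only [key, disjointMass_sum, disjointMass_const_mul]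
  have hI : intersectMass (fun x y => if P.eval (φ x) (ψ y) then 0 else 1) =
      ∑ j, (if out j then 0 else 1) * intersectMass fun x y => f j x * g j y := by
    have key (x y) := hsum' (fun b _ => if b then 0 else 1) x y
    simp only [key, intersectMass_sum, intersectMass_const_mul]
  have ent0 (j) : 0 ≤ ∑ A : Finset ι, Real.negMulLog (cubeMean A (f j) * cubeMean Aᶜ (g j)) :=
    Finset.sum_nonneg fun A _ => Real.negMulLog_nonneg (q0 j A) (q1 j A)
  calc _ = ∑ j, (if out j then 0 else 1) *
        (Fintype.card ι * disjointMass (fun x y => f j x * g j y) -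
          2 * intersectMass (fun x y => f j x * g j y)) := by
        rw [hD, hI, Finset.mul_sum, Finset.mul_sum, ← Finset.sum_sub_distrib]
        exact Finset.sum_congr rfl fun j _ => by ring
    _ ≤ ∑ j, 5 / 2 * (θ * Fintype.card ι * disjointMass (fun x y => f j x * g j y) +
          2 / θ * ∑ A : Finset ι, Real.negMulLog (cubeMean A (f j) * cubeMean Aᶜ (g j))) := by
        refine Finset.sum_le_sum fun j _ => ?_
        have hle := _root_.disjointMass_sub_intersectMass_le hθ (hfb j) (hgb j)
        have hnn : 0 ≤ disjointMass fun x y => f j x * g j y := by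
          rw [disjointMass_mul]
          exact Finset.sum_nonneg fun A _ => q0 j A
        -- Accepting leaves have weight 0 on the left, and their right-hand side is nonnegative.
        split_ifs
        · rw [zero_mul]
          have := ent0 j
          positivity
        · rwa [one_mul]
    _ = 5 / 2 * (θ * Fintype.card ι *
          (∑ A : Finset ι, ∑ j, cubeMean A (f j) * cubeMean Aᶜ (g j)) +
          2 / θ * ∑ A : Finset ι, ∑ j, Real.negMulLog (cubeMean A (f j) * cubeMean Aᶜ (g j))) := by
        simp only [disjointMass_mul]
        rw [← Finset.mul_sum, Finset.sum_add_distrib, ← Finset.mul_sum, ← Finset.mul_sum,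
          Finset.sum_comm, Finset.sum_comm (s := Finset.univ (α := κ))]
    _ ≤ 5 / 2 * (θ * Fintype.card ι * (∑ _A : Finset ι, 1) +
          2 / θ * ∑ _A : Finset ι, (k : ℝ)) := by
        simp only [qone]
        gcongr
        exact entropy _
    _ = _ := by
        simp only [Finset.sum_const, Finset.card_univ, Fintype.card_finset, nsmul_eq_mul]
        push_cast
        ring

end Disjointness

/-! ### Averaging over the public coins. -/

theorem PMF.toOuterMeasure_ne_top {α : Type*} (p : PMF α) (s : Set α) :
    p.toOuterMeasure s ≠ ⊤ := by
  rw [p.toOuterMeasure_apply]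
  exact ne_top_of_le_ne_top p.tsum_coe_ne_top
    (ENNReal.tsum_le_tsum fun a => Set.indicator_le_self s p a)

theorem PMF.hasSum_toOuterMeasure {α : Type*} (p : PMF α) (s : Set α) :
    HasSum (s.indicator fun a => (p a).toReal) (p.toOuterMeasure s).toReal := by
  have hne := p.toOuterMeasure_ne_top s
  rw [p.toOuterMeasure_apply] at hne ⊢
  have h := ENNReal.hasSum_toReal hne
  rw [← ENNReal.tsum_toReal_eq fun a => ENNReal.ne_top_of_tsum_ne_top hne a] at h
  convert h using 2 with a
  by_cases ha : a ∈ s <;> simp [ha]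

theorem PMF.toReal_toOuterMeasure_add_compl {α : Type*} (p : PMF α) (s : Set α) :
    (p.toOuterMeasure s).toReal + (p.toOuterMeasure sᶜ).toReal = 1 := by
  have h := (p.hasSum_toOuterMeasure s).add (p.hasSum_toOuterMeasure sᶜ)
  have h1 := p.hasSum_toOuterMeasure Set.univ
  rw [(p.toOuterMeasure_apply_eq_one_iff _).2 (Set.subset_univ _), ENNReal.toReal_one,
    Set.indicator_univ] at h1
  rw [← Set.indicator_self_add_compl s fun a => (p a).toReal] at h1
  exact h.unique h1

/-- Linear lower bound for any problem in which set disjointness can be embedded. -/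
theorem RandomizedProtocol.card_le_of_embeds_disjointness {ι : Type*} [Fintype ι]
    [DecidableEq ι] {X Y : Type} {R : RandomizedProtocol X Y} {p : X → Y → Prop}
    (hR : R.Decides p) {k : ℕ} (hk : R.CostAtMost k) (φ : Finset ι → X) (ψ : Finset ι → Y)
    (hp : ∀ x y, p (φ x) (ψ y) ↔ (x ∩ y).Nonempty) :
    (Fintype.card ι : ℝ) ≤ 450 * k := by
  set reject : Finset ι → Finset ι → Set (Protocol X Y) := fun x y =>
    {P | P.eval (φ x) (ψ y) = true}ᶜ with hreject
  set r : Finset ι → Finset ι → ℝ := fun x y => (R.toOuterMeasure (reject x y)).toReal with hr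
  have hDec (x y) : (2 / 3 : ℝ) ≤
      (R.toOuterMeasure {P | P.eval (φ x) (ψ y) = true ↔ p (φ x) (ψ y)}).toReal := by
    simpa using ENNReal.toReal_mono (R.toOuterMeasure_ne_top _) (hR (φ x) (ψ y))
  have hdisj (x y) (h : Disjoint x y) : 2 / 3 ≤ r x y := by
    have hn : ¬ p (φ x) (ψ y) := by
      rwa [hp, Finset.not_nonempty_iff_eq_empty, ← Finset.disjoint_iff_inter_eq_empty]
    have := hDec x y
    simp only [hn, iff_false] at this
    exact this
  have hmeet (x y) (h : (x ∩ y).Nonempty) : r x y ≤ 1 / 3 := by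
    have := hDec x y
    simp only [(hp x y).2 h, iff_true] at this
    have := R.toReal_toOuterMeasure_add_compl {P | P.eval (φ x) (ψ y) = true}
    simp only [hr, hreject]
    linarith
  have hs (x y) : HasSum
      (fun P => (R P).toReal * if P.eval (φ x) (ψ y) then (0 : ℝ) else 1) (r x y) := by
    convert R.hasSum_toOuterMeasure (reject x y) using 2 with P
    by_cases h : P.eval (φ x) (ψ y) <;> simp [hreject, h]
  have hD := hasSum_disjointMass hs
  have hI := hasSum_intersectMass hs
  have hone : HasSum (fun P => (R P).toReal) 1 := by
    have h := R.hasSum_toOuterMeasure Set.univ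
    rwa [(R.toOuterMeasure_apply_eq_one_iff _).2 (Set.subset_univ _), ENNReal.toReal_one,
      Set.indicator_univ] at h
  -- Up to the factor 2 ^ n, the gap is at least (2/3 - 1/3) n = n/3. With θ = 1/15 the bound is n/6
  -- + 75 k, whence n ≤ 450 k.
  have hle := hasSum_le (fun P => ?_) ((hD.mul_left (Fintype.card ι : ℝ)).sub (hI.mul_left 2))
    (hone.mul_right
      (5 / 2 * ((1 / 15) * Fintype.card ι + 2 / (1 / 15) * k) * 2 ^ Fintype.card ι : ℝ))
  · have h1 := mul_le_mul_of_nonneg_left (le_disjointMass hdisj)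
      (Nat.cast_nonneg (α := ℝ) (Fintype.card ι))
    have h2 := intersectMass_le hmeet
    have hpow : (0 : ℝ) < 2 ^ Fintype.card ι := by positivity
    refine le_of_mul_le_mul_right ?_ hpow
    nlinarith
  · rw [disjointMass_const_mul, intersectMass_const_mul]
    -- The cost bound holds only on the support; elsewhere the weight vanishes.
    by_cases hP : P ∈ R.support
    · have := mul_le_mul_of_nonneg_left (P.disjointMass_sub_intersectMass_le φ ψ (hk P hP)
        (θ := 1 / 15) (by norm_num)) (ENNReal.toReal_nonneg (a := R P))
      linarith
    · rw [(R.apply_eq_zero_iff P).2 hP]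
      simp

/-! ### Embedding disjointness into hitting set existence. -/

theorem boolInner_ne_zero_iff {d : ℕ} (a b : Fin d → Bool) :
    boolInner a b ≠ 0 ↔ ∃ i, a i = true ∧ b i = true := by
  have h0 : ∀ i ∈ Finset.univ, (0 : ℝ) ≤ ((a i).toNat : ℝ) * ((b i).toNat : ℝ) :=
    fun i _ => by positivity
  rw [boolInner, Ne, Finset.sum_eq_zero_iff_of_nonneg h0]
  simp

/-- The vector `(bin i, ¬ bin i, t)` with `m` binary digits, the digits flipped by `s`. -/
def digitVector (m i : ℕ) (s t : Bool) (p : Fin (2 * m + 1)) : Bool :=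
  if (p : ℕ) < m then xor s (i.testBit p)
  else if (p : ℕ) < 2 * m then xor (!s) (i.testBit (p - m)) else t

theorem digitVector_last (m i : ℕ) (s t : Bool) :
    digitVector m i s t (Fin.last (2 * m)) = t := by
  unfold digitVector
  rw [if_neg (by simp; omega), if_neg (by simp)]

theorem digitVector_low {m i p : ℕ} (s t : Bool) (hp : p < m) :
    digitVector m i s t ⟨p, by omega⟩ = xor s (i.testBit p) := by
  simp [digitVector, hp]

theorem digitVector_high {m i p : ℕ} (s t : Bool) (hp : p < m) :
    digitVector m i s t ⟨m + p, by omega⟩ = xor (!s) (i.testBit p) := by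
  simp only [digitVector]
  rw [if_neg (by omega), if_pos (by omega), Nat.add_sub_cancel_left]

theorem exists_testBit_ne {m i j : ℕ} (hi : i < 2 ^ m) (hj : j < 2 ^ m) (h : i ≠ j) :
    ∃ p < m, i.testBit p ≠ j.testBit p := by
  by_contra! hc
  refine h (Nat.eq_of_testBit_eq fun p => ?_)
  rcases lt_or_ge p m with hp | hp
  · exact hc p hp
  · have := Nat.pow_le_pow_right (n := 2) (by norm_num) hp
    rw [Nat.testBit_lt_two_pow (hi.trans_le this), Nat.testBit_lt_two_pow (hj.trans_le this)]

theorem digitVector_eq_index {m i j : ℕ} {s t t' : Bool} (hi : i < 2 ^ m) (hj : j < 2 ^ m)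
    (h : digitVector m i s t = digitVector m j s t') : i = j := by
  by_contra hne
  obtain ⟨p, hp, hb⟩ := exists_testBit_ne hi hj hne
  have := congrFun h ⟨p, by omega⟩
  rw [digitVector_low _ _ hp, digitVector_low _ _ hp] at this
  exact hb (by simpa using this)

/-- Flipped digits never meet for equal indices. For different ones, a differing digit gives a
common 1 in the lower half if i has digit 1 there, and in the upper half otherwise. -/
theorem boolInner_digitVector {m i j : ℕ} (t t' : Bool) (hi : i < 2 ^ m) (hj : j < 2 ^ m) :
    boolInner (digitVector m i false t) (digitVector m j true t') ≠ 0 ↔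
      (i = j → t = true ∧ t' = true) := by
  rw [boolInner_ne_zero_iff]
  constructor
  · rintro ⟨p, h1, h2⟩ rfl
    unfold digitVector at h1 h2
    split_ifs at h1 h2 <;> simp_all
  · intro h
    by_cases hij : i = j
    · exact ⟨Fin.last _, by rw [digitVector_last]; exact (h hij).1,
        by rw [digitVector_last]; exact (h hij).2⟩
    · obtain ⟨p, hp, hb⟩ := exists_testBit_ne hi hj hij
      cases hip : i.testBit p
      · refine ⟨⟨m + p, by omega⟩, ?_⟩
        rw [digitVector_high _ _ hp, digitVector_high _ _ hp]
        rw [hip] at hb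
        simp [hip, Bool.eq_true_of_not_eq_false hb.symm]
      · refine ⟨⟨p, by omega⟩, ?_⟩
        rw [digitVector_low _ _ hp, digitVector_low _ _ hp]
        rw [hip] at hb
        simp [hip, Bool.eq_false_of_not_eq_true hb.symm]

/-- The set of vectors that encodes a subset `x` of `Fin N`. -/
def encodeSet {N m : ℕ} (hN : N ≤ 2 ^ m) (s : Bool) (x : Finset (Fin N)) :
    VectorSet N (2 * m + 1) :=
  ⟨Finset.univ.image fun i : Fin N => digitVector m i s (decide (i ∈ x)), by
    rw [Finset.card_image_of_injective, Finset.card_univ, Fintype.card_fin]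
    intro i j h
    exact Fin.ext (digitVector_eq_index (i.2.trans_le hN) (j.2.trans_le hN) h)⟩

/-- Alice's vector i meets every Bob vector j ≠ i automatically, so only j = i is a test, and it
asks whether i is in x ∩ y. -/
theorem hittingSetExists_encodeSet {N m : ℕ} (hN : N ≤ 2 ^ m) (x y : Finset (Fin N)) :
    HittingSetExists (encodeSet hN false x) (encodeSet hN true y) ↔ (x ∩ y).Nonempty := by
  have key (i j : Fin N) := boolInner_digitVector (m := m) (decide (i ∈ x)) (decide (j ∈ y))
    (i.2.trans_le hN) (j.2.trans_le hN)
  simp only [HittingSetExists, encodeSet, Finset.mem_image, Finset.mem_univ, true_and,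
    exists_exists_eq_and, forall_exists_index, forall_apply_eq_imp_iff, key, decide_eq_true_eq]
  constructor
  · rintro ⟨i, hi⟩
    exact ⟨i, Finset.mem_inter.2 (hi i rfl)⟩
  · rintro ⟨i, hi⟩
    rw [Finset.mem_inter] at hi
    refine ⟨i, fun j hij => ⟨hi.1, ?_⟩⟩
    rw [← Fin.ext hij]
    exact hi.2

theorem mainTheorem11 :
    ∃ c : ℝ, 0 < c ∧ ∀ (N d : ℕ), d = 2 * Nat.clog 2 N + 1 →
      ∀ R : RandomizedProtocol (VectorSet N d) (VectorSet N d),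
        R.Decides HittingSetExists → ∀ k : ℕ, R.CostAtMost k → c * (N : ℝ) ≤ (k : ℝ) := by
  refine ⟨1 / 450, by norm_num, ?_⟩
  rintro N d rfl R hR k hk
  -- For N = 0 the value `Nat.clog 2 0 = 0` gives dimension 1.
  have hN : N ≤ 2 ^ Nat.clog 2 N := Nat.le_pow_clog (by norm_num) N
  have h := RandomizedProtocol.card_le_of_embeds_disjointness hR hk (encodeSet hN false)
    (encodeSet hN true) (hittingSetExists_encodeSet hN)
  rw [Fintype.card_fin] at h
  linarith
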